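/- Consider quantum query algorithms with the oracle $O_x|i,b\rangle=|i,b\oplus x_i\rangle$ for an input $x\in\{0,1\}^n$; a $k$-query algorithm prepares a state $U_kO_xU_{k-1}\cdots O_xU_0|0\rangle$ with unitaries $U_0,\dots,U_k$ that do not depend on $x$ and may act on any finite number of additional workspace qubits. For a total Boolean function $f:\{0,1\}^n\to\{0,1\}$ let - $Q(f)$ be the least $k$ such that some $k$-query algorithm, after measurement, outputs $f(x)$ with probability at least $2/3$ on every $x$; - $QS(f)$ (quantum distinguishing complexity) be the least $k$ such that some $k$-query algorithm outputs (possibly mixed, obtained by tracing out part of the registers) states $\rho_x$ with $\frac12\|\rho_x-\rho_y\|_1\ge 1/6$ whenever $f(x)\ne f(y)$; - $Q_0(f)$ (zero-error quantum query complexity) be the least $k$ such that some $k$-query algorithm, on every $x$, never outputs a wrong value and outputs "?" with probability at most $1/2$. **Theorem.** There is an absolute constant $C>0$ such that for every $n$ and every total function $f:\{0,1\}^n\to\{0,1\}$, $$Q_0(f)\le C\,QS(f)^5\log(QS(f)+1),\qquad QS(f)^5\log(QS(f)+1)\le C\,Q(f)^5\log(Q(f)+1),\qquad Q_0(f)\le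 C\,Q(f)^5\log(Q(f)+1);$$ that is, $Q_0(f)=O(QS(f)^5\log QS(f))=O(Q(f)^5\log Q(f))$. Moreover, the upper bounds on the number of queries are attained by a self-certifying zero-error algorithm: there is a $k$-query algorithm with $k\le C\,QS(f)^5\log(QS(f)+1)$ and $k\le C\,Q(f)^5\log(Q(f)+1)$ that on every input $x$ outputs "?" with probability at most $1/2$, and otherwise always outputs the value $f(x)$ together with a certificate for it, i.e. a set of positions with the bits of $x$ at these positions, such that $f(y)=f(x)$ for every $y\in\{0,1\}^n$ that agrees with these bits. -/

import Mathlib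

namespace QuantumQuery

open scoped Matrix

noncomputable section

/-- The standard basis of the space of a query algorithm: an index register, a query bit and a
workspace `W`. The index `none` is an idle value on which the oracle does nothing. -/
abbrev Basis (n : ℕ) (W : Type) : Type := Option (Fin n) × Bool × W

/-- The oracle for `x` on basis states: `|i, b, w⟩ ↦ |i, b ⊕ x i, w⟩`. -/
def oracleMap {n : ℕ} {W : Type} (x : Fin n → Bool) : Basis n W → Basis n W
  | (none, b, w) => (none, b, w)
  | (some i, b, w) => (some i, xor b (x i), w)

/-- The unitary oracle `O_x`: the permutation matrix that sends `|z⟩` to `|oracleMap x z⟩`. -/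
def oracle {n : ℕ} {W : Type} [DecidableEq W] (x : Fin n → Bool) :
    Matrix (Basis n W) (Basis n W) ℂ :=
  Matrix.of fun z' z => if z' = oracleMap x z then 1 else 0

/-- A quantum query algorithm on `n`-bit inputs: an initial basis state and oracle-independent
unitaries `U 0, U 1, …`. Run for `k` queries it uses `U 0, …, U k` only. -/
structure Algorithm (n : ℕ) (W : Type) [Fintype W] [DecidableEq W] where
  start : Basis n W
  U : ℕ → Matrix.unitaryGroup (Basis n W) ℂ

/-- The pure state `U_k O_x U_{k-1} ⋯ U_1 O_x U_0 |start⟩` after `k` queries to `x`. -/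
def Algorithm.state {n : ℕ} {W : Type} [Fintype W] [DecidableEq W] (A : Algorithm n W)
    (x : Fin n → Bool) : ℕ → (Basis n W → ℂ)
  | 0 => (A.U 0 : Matrix (Basis n W) (Basis n W) ℂ) *ᵥ Pi.single A.start 1
  | k + 1 => (A.U (k + 1) : Matrix (Basis n W) (Basis n W) ℂ) *ᵥ (oracle x *ᵥ A.state x k)

/-- Measuring all registers of `ψ` in the standard basis and applying the classical map `out`
to the result, the probability of the output `r`. -/
def outProb {Z R : Type} [Fintype Z] [DecidableEq R] (ψ : Z → ℂ) (out : Z → R) (r : R) : ℝ :=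
  ∑ z : Z with out z = r, ‖ψ z‖ ^ 2

/-- The operator `Tr_S |ψ⟩⟨ψ|` on the register `A`, for a factorization `e` of the basis `Z`
into a kept register `A` and a discarded register `S`. -/
def reducedState {Z A S : Type} [Fintype S] (e : Z ≃ A × S) (ψ : Z → ℂ) : Matrix A A ℂ :=
  Matrix.of fun a a' => ∑ s : S, ψ (e.symm (a, s)) * star (ψ (e.symm (a', s)))

/-- The trace norm `Tr √(Mᴴ M)`, the sum of the singular values of `M`. -/
def traceNorm {A : Type} [Fintype A] [DecidableEq A] (M : Matrix A A ℂ) : ℝ :=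
  ∑ a, Real.sqrt ((Matrix.isHermitian_conjTranspose_mul_self M).eigenvalues a)

/-- The trace distance of two density matrices. -/
def traceDist {A : Type} [Fintype A] [DecidableEq A] (ρ σ : Matrix A A ℂ) : ℝ :=
  traceNorm (ρ - σ) / 2

/-- Some `k`-query quantum algorithm outputs `f x` with probability at least `2/3`
on every input `x`. -/
def BoundedErrorComputable {n : ℕ} (f : (Fin n → Bool) → Bool) (k : ℕ) : Prop :=
  ∃ (W : Type) (_ : Fintype W) (_ : DecidableEq W) (A : Algorithm n W) (out : Basis n W → Bool),
    ∀ x, 2 / 3 ≤ outProb (A.state x k) out (f x)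

/-- Some `k`-query quantum algorithm outputs (possibly mixed) states for `x` and `y` that are at
trace distance at least `1/6` whenever `f x ≠ f y`. -/
def Distinguishable {n : ℕ} (f : (Fin n → Bool) → Bool) (k : ℕ) : Prop :=
  ∃ (W : Type) (_ : Fintype W) (_ : DecidableEq W) (A : Algorithm n W)
    (K S : Type) (_ : Fintype K) (_ : DecidableEq K) (_ : Fintype S) (e : Basis n W ≃ K × S),
    ∀ x y, f x ≠ f y →
      1 / 6 ≤ traceDist (reducedState e (A.state x k)) (reducedState e (A.state y k))

/-- Some `k`-query quantum algorithm never outputs a wrong answer, and on every input outputs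
`none` (the answer `?`) with probability at most `1/2`. -/
def ZeroErrorComputable {n : ℕ} (f : (Fin n → Bool) → Bool) (k : ℕ) : Prop :=
  ∃ (W : Type) (_ : Fintype W) (_ : DecidableEq W) (A : Algorithm n W)
    (out : Basis n W → Option Bool),
    ∀ x, outProb (A.state x k) out (some (!f x)) = 0 ∧ outProb (A.state x k) out none ≤ 1 / 2

/-- The input `x` agrees with the partial assignment `p`. -/
def Consistent {n : ℕ} (p : Fin n → Option Bool) (x : Fin n → Bool) : Prop :=
  ∀ i b, p i = some b → x i = b

/-- The partial assignment `p` is a certificate for `x`: it consists of bits of `x`, and these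
bits determine the value of `f`. -/
def IsCertificate {n : ℕ} (f : (Fin n → Bool) → Bool) (x : Fin n → Bool)
    (p : Fin n → Option Bool) : Prop :=
  Consistent p x ∧ ∀ y, Consistent p y → f y = f x

/-- Some `k`-query self-certifying zero-error quantum algorithm computes `f`: it outputs `none`
(the answer `?`) with probability at most `1/2`, and every other output of nonzero probability is
the value `f x` together with a certificate for `x`. -/
def SelfCertifyingComputable {n : ℕ} (f : (Fin n → Bool) → Bool) (k : ℕ) : Prop :=
  ∃ (W : Type) (_ : Fintype W) (_ : DecidableEq W) (A : Algorithm n W)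
    (out : Basis n W → Option (Bool × (Fin n → Option Bool))),
    ∀ x, (∀ b p, outProb (A.state x k) out (some (b, p)) ≠ 0 → b = f x ∧ IsCertificate f x p) ∧
      outProb (A.state x k) out none ≤ 1 / 2

/-- Bounded-error quantum query complexity. -/
def Q {n : ℕ} (f : (Fin n → Bool) → Bool) : ℕ := sInf {k | BoundedErrorComputable f k}

/-- Quantum distinguishing complexity. -/
def QS {n : ℕ} (f : (Fin n → Bool) → Bool) : ℕ := sInf {k | Distinguishable f k}

/-- Zero-error quantum query complexity. -/
def Q₀ {n : ℕ} (f : (Fin n → Bool) → Bool) : ℕ := sInf {k | ZeroErrorComputable f k}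

end

end QuantumQuery

/-! Fix a `k`-query algorithm whose outputs distinguish the values of `f`. By the hybrid argument
(`one_le_sum_queryWeight`), on every input it places total query weight at least `1 / (144 k)` on
each sensitive block. Disjoint blocks share weight at most `k`, so block sensitivity is at most `144
k²`.

Bounded block sensitivity `s` makes minimal sensitive blocks scarce: each has at most `s` elements,
and there are at most `(2 s²) ^ s = exp (O (k² log k))` of them (`card_minSensitiveBlocks_le`).

Measuring the index register before each query and reading the bit found there costs at most `k²`
queries per round. After `m` rounds a given block is missed with probability at most `exp (-m / (144
k))`, so `m = O (k³ log k)` rounds suffice for a union bound over all minimal sensitive blocks. Bits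
meeting all these blocks form a certificate, which gives a self-certifying algorithm with `O (k⁵ log
k)` queries. The bounds in terms of `Q` follow from `QS ≤ Q`. -/

namespace QuantumQuery

open scoped Matrix

/-! ### Building query algorithms: unitaries, queries, tensor products, norm preservation. -/

section States

variable {n : ℕ} {W W' V : Type}

theorem oracleMap_involutive (x : Fin n → Bool) :
    Function.Involutive (oracleMap x : Basis n W → Basis n W) := by
  rintro ⟨_ | i, b, w⟩ <;> simp [oracleMap]

/-- The oracle as a permutation of the standard basis. -/
def oraclePerm (x : Fin n → Bool) : Equiv.Perm (Basis n W) :=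
  (oracleMap_involutive x).toPerm

theorem oracleMap_fst (x : Fin n → Bool) (z : Basis n W) : (oracleMap x z).1 = z.1 := by
  obtain ⟨_ | i, b, w⟩ := z <;> rfl

/-- Split off a part of the workspace. -/
def splitWorkspace (n : ℕ) (W V : Type) : Basis n (W × V) ≃ Basis n W × V where
  toFun z := ((z.1, z.2.1, z.2.2.1), z.2.2.2)
  invFun p := (p.1.1, p.1.2.1, p.1.2.2, p.2)

theorem splitWorkspace_oracleMap (x : Fin n → Bool) (z : Basis n (W × V)) :
    splitWorkspace n W V (oracleMap x z) =
      (oracleMap x (splitWorkspace n W V z).1, (splitWorkspace n W V z).2) := by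
  obtain ⟨_ | i, b, w⟩ := z <;> rfl

/-- Split off the basis of another algorithm, stored in the workspace, except that the query
registers of that algorithm are exchanged with the active ones. -/
def splitSwapped (n : ℕ) (W W' : Type) :
    Basis n (W' × Basis n W) ≃ Basis n W × Basis n W' where
  toFun z := ((z.1, z.2.1, z.2.2.2.2.2), (z.2.2.2.1, z.2.2.2.2.1, z.2.2.1))
  invFun p := (p.1.1, p.1.2.1, p.2.2.2, p.2.1, p.2.2.1, p.1.2.2)

theorem splitSwapped_oracleMap (x : Fin n → Bool) (z : Basis n (W' × Basis n W)) :
    splitSwapped n W W' (oracleMap x z) =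
      (oracleMap x (splitSwapped n W W' z).1, (splitSwapped n W W' z).2) := by
  obtain ⟨_ | i, b, w⟩ := z <;> rfl

variable [Fintype W] [DecidableEq W]

theorem oracle_mulVec (x : Fin n → Bool) (ψ : Basis n W → ℂ) :
    oracle x *ᵥ ψ = ψ ∘ oracleMap x := by
  ext z
  have h : ∀ z', (z = oracleMap x z') ↔ (oracleMap x z = z') := fun z' =>
    ⟨fun h => by rw [h, oracleMap_involutive x], fun h => by rw [← h, oracleMap_involutive x]⟩
  simp [Matrix.mulVec, dotProduct, oracle, h]

theorem permMatrix_mem_unitaryGroup {Z : Type} [Fintype Z] [DecidableEq Z] (σ : Equiv.Perm Z) :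
    σ.permMatrix ℂ ∈ Matrix.unitaryGroup Z ℂ := by
  rw [Matrix.mem_unitaryGroup_iff, Matrix.star_eq_conjTranspose, Matrix.conjTranspose_permMatrix,
    ← Matrix.permMatrix_mul]
  simp

/-- The family `ψ` of states is produced by some `k`-query algorithm with workspace `W`. -/
def Reaches (k : ℕ) (ψ : (Fin n → Bool) → Basis n W → ℂ) : Prop :=
  ∃ A : Algorithm n W, ∀ x, A.state x k = ψ x

theorem Algorithm.state_congr {A B : Algorithm n W} (x : Fin n → Bool) {k : ℕ}
    (hs : A.start = B.start) (hU : ∀ j ≤ k, A.U j = B.U j) : A.state x k = B.state x k := by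
  induction k with
  | zero => simp [Algorithm.state, hs, hU]
  | succ k ih => simp [Algorithm.state, hU, ih fun j hj => hU j (by omega)]

theorem reaches_single (z : Basis n W) : Reaches 0 fun _ => Pi.single z (1 : ℂ) :=
  ⟨⟨z, fun _ => 1⟩, fun x => by simp [Algorithm.state, -Matrix.mulVec_single]⟩

theorem Reaches.mulVec {k : ℕ} {ψ : (Fin n → Bool) → Basis n W → ℂ} (h : Reaches k ψ)
    {M : Matrix (Basis n W) (Basis n W) ℂ} (hM : M ∈ Matrix.unitaryGroup (Basis n W) ℂ) :
    Reaches k fun x => M *ᵥ ψ x := by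
  obtain ⟨A, hA⟩ := h
  refine ⟨⟨A.start, Function.update A.U k (⟨M, hM⟩ * A.U k)⟩, fun x => ?_⟩
  change _ = M *ᵥ ψ x
  rw [← hA]
  cases k with
  | zero => simp [Algorithm.state, -Matrix.mulVec_single]
  | succ k =>
    have : Algorithm.state ⟨A.start, Function.update A.U (k + 1) (⟨M, hM⟩ * A.U (k + 1))⟩ x k
        = A.state x k := by
      refine Algorithm.state_congr x rfl fun j hj => ?_
      simp [Function.update_of_ne (show j ≠ k + 1 by omega)]
    simp [Algorithm.state, this, Matrix.mul_assoc]

theorem Reaches.perm {k : ℕ} {ψ : (Fin n → Bool) → Basis n W → ℂ} (h : Reaches k ψ)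
    (σ : Equiv.Perm (Basis n W)) : Reaches k fun x => ψ x ∘ σ := by
  simpa [Matrix.permMatrix_mulVec] using h.mulVec (permMatrix_mem_unitaryGroup σ)

theorem Reaches.query {k : ℕ} {ψ : (Fin n → Bool) → Basis n W → ℂ} (h : Reaches k ψ) :
    Reaches (k + 1) fun x => ψ x ∘ oracleMap x := by
  obtain ⟨A, hA⟩ := h
  refine ⟨⟨A.start, Function.update A.U (k + 1) 1⟩, fun x => ?_⟩
  have : Algorithm.state ⟨A.start, Function.update A.U (k + 1) 1⟩ x k = A.state x k := by
    refine Algorithm.state_congr x rfl fun j hj => ?_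
    simp [Function.update_of_ne (show j ≠ k + 1 by omega)]
  simp [Algorithm.state, this, hA, oracle_mulVec]

open scoped Kronecker in
/-- A unitary on one tensor factor acts on a product vector. -/
theorem exists_unitary_mulVec_factor {Z Z₁ Z₂ : Type} [Fintype Z] [DecidableEq Z] [Fintype Z₁]
    [DecidableEq Z₁] [Fintype Z₂] [DecidableEq Z₂] (g : Z ≃ Z₁ × Z₂)
    (M : Matrix.unitaryGroup Z₁ ℂ) :
    ∃ N ∈ Matrix.unitaryGroup Z ℂ, ∀ (φ : Z₁ → ℂ) (χ : Z₂ → ℂ),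
      N *ᵥ (fun z => φ (g z).1 * χ (g z).2) =
        fun z => ((M : Matrix Z₁ Z₁ ℂ) *ᵥ φ) (g z).1 * χ (g z).2 := by
  refine ⟨((M : Matrix Z₁ Z₁ ℂ) ⊗ₖ (1 : Matrix Z₂ Z₂ ℂ)).submatrix g g, ?_, fun φ χ => ?_⟩
  · have h : ((M : Matrix Z₁ Z₁ ℂ) ⊗ₖ (1 : Matrix Z₂ Z₂ ℂ)) ∈ Matrix.unitaryGroup (Z₁ × Z₂) ℂ :=
      Matrix.kronecker_mem_unitary M.2 (one_mem _)
    rw [Matrix.mem_unitaryGroup_iff, Matrix.star_eq_conjTranspose] at h ⊢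
    rw [Matrix.conjTranspose_submatrix, Matrix.submatrix_mul_equiv, h, Matrix.submatrix_one_equiv]
  · ext z
    simp only [Matrix.mulVec, dotProduct, Matrix.submatrix_apply]
    rw [g.sum_comp fun p => ((M : Matrix Z₁ Z₁ ℂ) ⊗ₖ (1 : Matrix Z₂ Z₂ ℂ)) (g z) p *
      (φ p.1 * χ p.2), Fintype.sum_prod_type, Finset.sum_mul]
    refine Finset.sum_congr rfl fun a _ => ?_
    rw [Finset.sum_eq_single (g z).2 (by
      intro b _ hb
      simp [Matrix.kroneckerMap_apply, Matrix.one_apply_ne hb.symm]) (by simp)]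
    simp [Matrix.kroneckerMap_apply]
    ring

/-- An algorithm can be run on one tensor factor that contains the query registers. -/
theorem Reaches.run [Fintype W'] [DecidableEq W'] [Fintype V] [DecidableEq V]
    (A : Algorithm n W') (g : Basis n W ≃ Basis n W' × V)
    (hg : ∀ x z, g (oracleMap x z) = (oracleMap x (g z).1, (g z).2))
    {m : ℕ} {χ : (Fin n → Bool) → V → ℂ}
    (h : Reaches m fun x z => (Pi.single A.start 1 : Basis n W' → ℂ) (g z).1 * χ x (g z).2)
    (k : ℕ) : Reaches (m + k) fun x z => A.state x k (g z).1 * χ x (g z).2 := by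
  induction k with
  | zero =>
    obtain ⟨N, hN, h'⟩ := exists_unitary_mulVec_factor g (A.U 0)
    simpa [h', Algorithm.state] using h.mulVec hN
  | succ k ih =>
    obtain ⟨N, hN, h'⟩ := exists_unitary_mulVec_factor g (A.U (k + 1))
    have := ih.query.mulVec hN
    simp only [Function.comp_def, hg] at this
    have e : (fun x z => A.state x (k + 1) (g z).1 * χ x (g z).2) = fun x =>
        N *ᵥ fun z => A.state x k (oracleMap x (g z).1) * χ x (g z).2 := by
      funext x
      rw [Algorithm.state, oracle_mulVec]
      exact (h' (A.state x k ∘ oracleMap x) (χ x)).symm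
    rw [e]
    exact this

theorem reaches_product [Fintype W'] [DecidableEq W'] [Fintype V] [DecidableEq V]
    (g : Basis n W ≃ Basis n W' × V) (a : Basis n W') (v : V) :
    Reaches 0 fun (_ : Fin n → Bool) z => (Pi.single a 1 : Basis n W' → ℂ) (g z).1 *
      (Pi.single v 1 : V → ℂ) (g z).2 := by
  convert reaches_single (g.symm (a, v)) using 3 with x z
  simp only [Pi.single_apply, Equiv.eq_symm_apply, Prod.ext_iff]
  split_ifs <;> simp_all

/-- Only one pair of query registers is active. `A` runs first while the query registers of `B` wait
in the workspace; a basis permutation then exchanges the two pairs and `B` runs. -/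
theorem Reaches.tensor [Fintype W'] [DecidableEq W'] (A : Algorithm n W) (B : Algorithm n W')
    (k l : ℕ) :
    ∃ g : Basis n (W' × Basis n W) ≃ Basis n W' × Basis n W,
      Reaches (k + l) fun x z => B.state x l (g z).1 * A.state x k (g z).2 := by
  refine ⟨splitWorkspace n W' (Basis n W), ?_⟩
  refine Reaches.run (χ := fun x => A.state x k) B _ splitWorkspace_oracleMap ?_ l
  have h := (Reaches.run (χ := fun _ => (Pi.single B.start 1 : Basis n W' → ℂ)) A
    (splitSwapped n W W') splitSwapped_oracleMap (reaches_product _ _ _) k).perm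
    (((splitWorkspace n W' (Basis n W)).trans (Equiv.prodComm _ _)).trans
      (splitSwapped n W W').symm)
  rw [zero_add] at h
  refine cast (congrArg _ ?_) h
  funext x z
  simp only [Function.comp_apply, Equiv.trans_apply, Equiv.apply_symm_apply, Equiv.prodComm_apply,
    Prod.fst_swap, Prod.snd_swap]
  exact mul_comm _ _

/-- The squared norm of a state vector. -/
noncomputable def normSq {Z : Type} [Fintype Z] (ψ : Z → ℂ) : ℝ := ∑ z, ‖ψ z‖ ^ 2

theorem normSq_mulVec {Z : Type} [Fintype Z] [DecidableEq Z] (M : Matrix.unitaryGroup Z ℂ)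
    (ψ : Z → ℂ) : normSq ((M : Matrix Z Z ℂ) *ᵥ ψ) = normSq ψ := by
  have key : ∀ φ : Z → ℂ, (normSq φ : ℂ) = star φ ⬝ᵥ φ := by
    intro φ
    simp only [normSq, dotProduct, Complex.ofReal_sum, Pi.star_apply]
    refine Finset.sum_congr rfl fun z _ => ?_
    rw [mul_comm, Complex.star_def, Complex.mul_conj, Complex.normSq_eq_norm_sq]
  have := key ((M : Matrix Z Z ℂ) *ᵥ ψ)
  rw [Matrix.star_mulVec, Matrix.dotProduct_mulVec, Matrix.vecMul_vecMul,
    ← Matrix.star_eq_conjTranspose, Matrix.mem_unitaryGroup_iff'.1 M.2, Matrix.vecMul_one,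
    ← key] at this
  exact_mod_cast this

theorem normSq_oracle (x : Fin n → Bool) (ψ : Basis n W → ℂ) :
    normSq (oracle x *ᵥ ψ) = normSq ψ := by
  rw [oracle_mulVec]
  exact Equiv.sum_comp (oraclePerm x) fun z => ‖ψ z‖ ^ 2

theorem Algorithm.normSq_state (A : Algorithm n W) (x : Fin n → Bool) (k : ℕ) :
    normSq (A.state x k) = 1 := by
  induction k with
  | zero =>
    rw [Algorithm.state, normSq_mulVec, normSq, Finset.sum_eq_single A.start] <;>
      simp +contextual
  | succ k ih => rw [Algorithm.state, normSq_mulVec, normSq_oracle, ih]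

end States

/-! ### Algorithms that collect input bits. -/

section Exploration

variable {n : ℕ}

open Classical in
/-- The probability that the partial assignment read off from `ψ` leaves `B` untouched. -/
noncomputable def missProb {Z : Type} [Fintype Z] (ψ : Z → ℂ) (out : Z → Fin n → Option Bool)
    (B : Finset (Fin n)) : ℝ :=
  ∑ z, if ∀ i ∈ B, out z i = none then ‖ψ z‖ ^ 2 else 0

open Classical in
/-- The probability of finding the index register of `ψ` in `B`. -/
noncomputable def queryWeight {W : Type} [Fintype W] (ψ : Basis n W → ℂ) (B : Finset (Fin n)) : ℝ :=
  ∑ z, if ∃ i ∈ B, z.1 = some i then ‖ψ z‖ ^ 2 else 0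

/-- Some `k`-query algorithm finds bits of its input `x`, and misses each set `B` of positions with
probability at most `q x B`. -/
def Explores (k : ℕ) (q : (Fin n → Bool) → Finset (Fin n) → ℝ) : Prop :=
  ∃ (W : Type) (_ : Fintype W) (_ : DecidableEq W) (A : Algorithm n W)
    (out : Basis n W → Fin n → Option Bool), ∀ x,
      (∀ z, A.state x k z ≠ 0 → Consistent (out z) x) ∧
      ∀ B, missProb (A.state x k) out B ≤ q x B

theorem missProb_nonneg {Z : Type} [Fintype Z] (ψ : Z → ℂ) (out : Z → Fin n → Option Bool)
    (B : Finset (Fin n)) : 0 ≤ missProb ψ out B :=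
  Finset.sum_nonneg fun z _ => by split_ifs <;> positivity

theorem queryWeight_nonneg {W : Type} [Fintype W] (ψ : Basis n W → ℂ) (B : Finset (Fin n)) : 0 ≤ queryWeight ψ B :=
  Finset.sum_nonneg fun z _ => by split_ifs <;> positivity

theorem explores_zero : Explores 0 fun (_ : Fin n → Bool) _ => 1 := by
  refine ⟨Unit, inferInstance, inferInstance, ⟨(none, false, ()), fun _ => 1⟩, fun _ _ => none,
    fun x => ⟨fun z _ i b h => by simp at h, fun B => ?_⟩⟩
  rw [← Algorithm.normSq_state ⟨(none, false, ()), fun _ => 1⟩ x 0]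
  exact Finset.sum_le_sum fun z _ => by simp

/-- On a product state the two outcomes are independent, and a block is missed by the merged
assignment exactly when both runs miss it. Where both find a bit, both are correct, so the
preference for the first is harmless. -/
theorem Explores.mul {k l : ℕ} {q r : (Fin n → Bool) → Finset (Fin n) → ℝ} (hq : Explores k q)
    (hr : Explores l r) : Explores (k + l) fun x B => q x B * r x B := by
  classical
  obtain ⟨W, _, _, A, out, hA⟩ := hq
  obtain ⟨W', _, _, A', out', hA'⟩ := hr
  obtain ⟨g, D, hD⟩ := Reaches.tensor A A' k l
  refine ⟨_, inferInstance, inferInstance, D,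
    fun z i => (out (g z).2 i).orElse fun _ => out' (g z).1 i, fun x => ⟨fun z hz i b hb => ?_,
    fun B => ?_⟩⟩
  · rw [hD] at hz
    have h1 := (hA x).1 _ (right_ne_zero_of_mul hz) i b
    have h2 := (hA' x).1 _ (left_ne_zero_of_mul hz) i b
    dsimp only at hb
    rcases h : out (g z).2 i with _ | c
    · rw [h] at hb
      exact h2 hb
    · rw [h] at hb h1
      exact h1 hb
  · refine le_trans (le_of_eq ?_) (mul_le_mul ((hA x).2 B) ((hA' x).2 B) (missProb_nonneg _ _ _)
      ((missProb_nonneg _ _ _).trans ((hA x).2 B)))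
    rw [hD, missProb, missProb, missProb, mul_comm, Finset.sum_mul_sum,
      ← Fintype.sum_prod_type', ← g.sum_comp]
    refine Finset.sum_congr rfl fun z _ => ?_
    have : (∀ i ∈ B, ((out (g z).2 i).orElse fun _ => out' (g z).1 i) = none) ↔
        (∀ i ∈ B, out' (g z).1 i = none) ∧ ∀ i ∈ B, out (g z).2 i = none := by
      rw [← forall₂_and]
      refine forall₂_congr fun i _ => ?_
      cases out (g z).2 i <;> simp
    simp only [this, norm_mul, mul_pow]
    split_ifs <;> first | (exfalso; tauto) | simp

/-- Run an algorithm for `t` queries, measure its index register and query the position found. -/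
theorem Explores.measure {W : Type} [Fintype W] [DecidableEq W] (A : Algorithm n W) (t : ℕ) :
    Explores (t + 1) fun x B => 1 - queryWeight (A.state x t) B := by
  classical
  -- Exchanging the query bit with a clean workspace bit makes the extra query write `x i` itself.
  -- That query preserves the index, so the measurement can be deferred to the end.
  let σ : Equiv.Perm (Basis n (W × Bool)) :=
    ⟨fun z => (z.1, z.2.2.2, z.2.2.1, z.2.1), fun z => (z.1, z.2.2.2, z.2.2.1, z.2.1),
      fun _ => rfl, fun _ => rfl⟩
  let g := splitWorkspace n W Bool
  obtain ⟨D, hD⟩ := ((Reaches.run (χ := fun _ => (Pi.single false 1 : Bool → ℂ)) A g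
    splitWorkspace_oracleMap (reaches_product _ _ _) t).perm σ).query
  rw [zero_add] at hD
  refine ⟨_, inferInstance, inferInstance, D, fun z i => if z.1 = some i then some z.2.1 else none,
    fun x => ⟨fun z hz i b hb => ?_, fun B => le_of_eq ?_⟩⟩
  · obtain ⟨o, c, w, d⟩ := z
    dsimp only at hb
    split_ifs at hb with h
    subst h
    rw [hD] at hz
    have := right_ne_zero_of_mul hz
    simp [σ, g, splitWorkspace, oracleMap, Pi.single_apply] at this hb
    grind
  · change _ = 1 - queryWeight (A.state x t) B
    rw [← A.normSq_state x t, normSq, queryWeight, ← Finset.sum_sub_distrib]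
    have e : ∀ z, D.state x (t + 1) z =
        A.state x t (g (σ (oracleMap x z))).1 * (Pi.single false 1 : Bool → ℂ)
          (g (σ (oracleMap x z))).2 := fun z => by rw [hD]; rfl
    have fst : ∀ z, (g (σ (oracleMap x z))).1.1 = z.1 := fun z => oracleMap_fst x z
    let F : Basis n W × Bool → ℝ := fun p => if ∃ i ∈ B, p.1.1 = some i then 0 else
      ‖A.state x t p.1‖ ^ 2 * ‖(Pi.single false 1 : Bool → ℂ) p.2‖ ^ 2
    calc missProb (D.state x (t + 1)) (fun z i => if z.1 = some i then some z.2.1 else none) B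
        = ∑ z, F (g (σ (oraclePerm x z))) := by
          refine Finset.sum_congr rfl fun z _ => ?_
          have : (∀ i ∈ B, (if z.1 = some i then some z.2.1 else none) = none) ↔
              ¬ ∃ i ∈ B, z.1 = some i := by simp
          rw [e, norm_mul, mul_pow]
          simp only [F, this, oraclePerm, Function.Involutive.coe_toPerm, fst, ite_not]
      _ = ∑ p, F p := by
          rw [Equiv.sum_comp (oraclePerm x) fun z => F (g (σ z)),
            Equiv.sum_comp σ fun z => F (g z), Equiv.sum_comp g F]
      _ = _ := by
          rw [Fintype.sum_prod_type]
          refine Finset.sum_congr rfl fun p _ => ?_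
          by_cases h : ∃ i ∈ B, p.1 = some i <;> simp [F, h]

theorem Explores.mono {k : ℕ} {q r : (Fin n → Bool) → Finset (Fin n) → ℝ} (h : Explores k q)
    (hqr : ∀ x B, q x B ≤ r x B) : Explores k r := by
  obtain ⟨W, i1, i2, A, out, hA⟩ := h
  exact ⟨W, i1, i2, A, out, fun x => ⟨(hA x).1, fun B => ((hA x).2 B).trans (hqr x B)⟩⟩

theorem Explores.prod {ι : Type*} (s : Finset ι) {k : ι → ℕ}
    {q : ι → (Fin n → Bool) → Finset (Fin n) → ℝ} (h : ∀ j ∈ s, Explores (k j) (q j)) :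
    Explores (∑ j ∈ s, k j) fun x B => ∏ j ∈ s, q j x B := by
  classical
  induction s using Finset.induction_on with
  | empty => simpa using explores_zero
  | insert a s ha ih =>
    simp only [Finset.sum_insert ha, Finset.prod_insert ha]
    exact (h a (Finset.mem_insert_self _ _)).mul
      (ih fun j hj => h j (Finset.mem_insert_of_mem hj))

/-- Querying all positions. -/
theorem explores_all : Explores n fun (_ : Fin n → Bool) B => if B.Nonempty then 0 else 1 := by
  -- Starting in index `j` with identity unitaries and measuring at time `0` finds position `j` with
  -- certainty, at the price of one query.
  have h := Explores.prod (Finset.univ : Finset (Fin n)) fun j _ =>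
    Explores.measure (⟨(some j, false, ()), fun _ => 1⟩ : Algorithm n Unit) 0
  simp only [zero_add, Finset.sum_const, Finset.card_univ, Fintype.card_fin, smul_eq_mul,
    mul_one] at h
  refine h.mono fun x B => ?_
  have hw : ∀ j, queryWeight
      (Algorithm.state (⟨(some j, false, ()), fun _ => 1⟩ : Algorithm n Unit) x 0) B =
      if j ∈ B then 1 else 0 := by
    intro j
    rw [queryWeight, Finset.sum_eq_single (some j, false, ())]
    · simp [Algorithm.state]
    · intro z _ hz
      simp [Algorithm.state, hz]
    · simp
  simp only [hw]
  split_ifs with hB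
  · obtain ⟨j, hj⟩ := hB
    exact (Finset.prod_eq_zero (Finset.mem_univ j) (by simp [hj])).le
  · rw [Finset.not_nonempty_iff_eq_empty.1 hB]
    simp

end Exploration

/-! ### Counting minimal sensitive blocks via block sensitivity. -/

section Sensitivity

variable {n : ℕ}

/-- The input `x` with the bits in `B` flipped. -/
def flipBits (x : Fin n → Bool) (B : Finset (Fin n)) : Fin n → Bool :=
  fun i => if i ∈ B then !x i else x i

theorem flipBits_flipBits (x : Fin n → Bool) (B B' : Finset (Fin n)) :
    flipBits (flipBits x B) B' = flipBits x (symmDiff B B') := by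
  ext i
  by_cases h : i ∈ B <;> by_cases h' : i ∈ B' <;> simp [flipBits, Finset.mem_symmDiff, h, h']

@[simp] theorem flipBits_empty (x : Fin n → Bool) : flipBits x ∅ = x := by
  ext i; simp [flipBits]

theorem flipBits_filter_ne (x y : Fin n → Bool) :
    flipBits x (Finset.univ.filter fun i => x i ≠ y i) = y := by
  ext i
  by_cases h : x i = y i
  · simp [flipBits, h]
  · simp only [flipBits, Finset.mem_filter, Finset.mem_univ, true_and, ne_eq, h, not_false_eq_true,
      if_true]
    cases hx : x i <;> cases hy : y i <;> simp_all

/-- `B` is inclusion-minimal among the blocks whose flip moves the value of `f` away from `v`. -/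
def IsMinBlock (f : (Fin n → Bool) → Bool) (v : Bool) (x : Fin n → Bool) (B : Finset (Fin n)) :
    Prop :=
  f (flipBits x B) ≠ v ∧ ∀ B' ⊂ B, f (flipBits x B') = v

/-- Every family of disjoint sensitive blocks of `f` has at most `s` members. -/
def BlockSensitivityLE (f : (Fin n → Bool) → Bool) (s : ℕ) : Prop :=
  ∀ (x : Fin n → Bool) (𝓑 : Finset (Finset (Fin n))),
    (𝓑 : Set (Finset (Fin n))).PairwiseDisjoint id → (∀ B ∈ 𝓑, f (flipBits x B) ≠ f x) →
    𝓑.card ≤ s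

variable {f : (Fin n → Bool) → Bool} {s : ℕ}

theorem exists_isMinBlock_subset {x : Fin n → Bool} {v : Bool} {B : Finset (Fin n)}
    (hB : f (flipBits x B) ≠ v) : ∃ B' ⊆ B, IsMinBlock f v x B' := by
  induction B using Finset.strongInduction with
  | H B ih =>
    by_cases h : ∀ B' ⊂ B, f (flipBits x B') = v
    · exact ⟨B, subset_rfl, hB, h⟩
    · push Not at h
      obtain ⟨B', hs, hB'⟩ := h
      obtain ⟨B'', h1, h2⟩ := ih B' hs hB'
      exact ⟨B'', h1.trans hs.1, h2⟩

theorem IsMinBlock.nonempty {x : Fin n → Bool} {B : Finset (Fin n)}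
    (hB : IsMinBlock f (f x) x B) : B.Nonempty := by
  rw [Finset.nonempty_iff_ne_empty]
  rintro rfl
  exact hB.1 (by simp)

/-- At the input `flipBits x B`, flipping back any single `i ∈ B` restores the value `f x` by
minimality, so the singletons in `B` are disjoint sensitive blocks there. -/
theorem IsMinBlock.card_le (hs : BlockSensitivityLE f s) {x : Fin n → Bool} {B : Finset (Fin n)}
    (hB : IsMinBlock f (f x) x B) : B.card ≤ s := by
  classical
  have h := hs (flipBits x B) (B.image fun i => {i}) ?_ ?_
  · rwa [Finset.card_image_of_injective _ Finset.singleton_injective] at h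
  · intro C hC D hD hCD
    simp only [Finset.coe_image, Set.mem_image, Finset.mem_coe] at hC hD
    obtain ⟨i, -, rfl⟩ := hC
    obtain ⟨j, -, rfl⟩ := hD
    simpa [Function.onFun] using fun h : i = j => hCD (by rw [h])
  · intro C hC
    obtain ⟨i, hi, rfl⟩ := Finset.mem_image.1 hC
    have e : symmDiff B {i} = B.erase i := by
      ext j
      by_cases h : j = i <;> simp [Finset.mem_symmDiff, h, hi]
    rw [flipBits_flipBits, e, hB.2 _ (Finset.erase_ssubset hi)]
    exact hB.1.symm

/-- Few positions meet all sensitive blocks of an input. -/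
theorem exists_hittingSet (hs : BlockSensitivityLE f s) (x : Fin n → Bool) :
    ∃ H : Finset (Fin n), H.card ≤ s * s ∧
      ∀ B, f (flipBits x B) ≠ f x → ∃ i ∈ B, i ∈ H := by
  classical
  let P : Finset (Finset (Fin n)) → Prop := fun 𝓑 =>
    (𝓑 : Set (Finset (Fin n))).PairwiseDisjoint id ∧ ∀ B ∈ 𝓑, IsMinBlock f (f x) x B
  -- The hitting set is the union of a maximal disjoint family of minimal blocks: at most `s` blocks
  -- of at most `s` elements. A sensitive block avoiding it would contain a minimal block that
  -- enlarges the family.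
  obtain ⟨𝓑, -, hmax⟩ := Finite.exists_le_maximal (p := P) (a := ∅) ⟨by simp, by simp⟩
  obtain ⟨hd, hm⟩ := hmax.1
  refine ⟨𝓑.biUnion id, ?_, fun B hB => ?_⟩
  · exact (Finset.card_biUnion_le_card_mul _ _ s fun B h => (hm B h).card_le hs).trans
      (Nat.mul_le_mul_right _ (hs x 𝓑 hd fun B h => (hm B h).1))
  · obtain ⟨B', hsub, hmin⟩ := exists_isMinBlock_subset hB
    by_contra! hno
    have hdisj : ∀ C ∈ 𝓑, Disjoint B' C := fun C hC =>
      Finset.disjoint_left.2 fun i hi hi' =>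
        hno i (hsub hi) (Finset.mem_biUnion.2 ⟨C, hC, hi'⟩)
    have hP : P (insert B' 𝓑) := by
      refine ⟨?_, ?_⟩
      · rw [Finset.coe_insert]
        exact hd.insert fun C hC _ => hdisj C hC
      · intro C hC
        rcases Finset.mem_insert.1 hC with rfl | hC
        · exact hmin
        · exact hm C hC
    have hmem : B' ∈ 𝓑 := hmax.2 hP (Finset.subset_insert _ _) (Finset.mem_insert_self _ _)
    obtain ⟨i, hi⟩ := hmin.nonempty
    exact Finset.disjoint_left.1 (hdisj B' hmem) hi hi

open Classical in
/-- The inclusion-minimal blocks of a given size. -/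
noncomputable def minBlocks (f : (Fin n → Bool) → Bool) (v : Bool) (x : Fin n → Bool) (l : ℕ) :
    Finset (Finset (Fin n)) :=
  Finset.univ.filter fun B => B.card = l ∧ IsMinBlock f v x B

/-- Choose an element `i` of the block in a hitting set, in at most `s²` ways; what remains of the
block is minimal for `flipBits x {i}` with the same `v`. The value `v` is kept separate from `f x`
because, for a one-element block, the flipped input already has a value other than `v`. -/
theorem card_minBlocks_le (hs : BlockSensitivityLE f s) (l : ℕ) (v : Bool) (x : Fin n → Bool) :
    (minBlocks f v x l).card ≤ (s * s) ^ l := by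
  classical
  induction l generalizing x with
  | zero =>
    refine Finset.card_le_one.2 fun B hB C hC => ?_
    simp only [minBlocks, Finset.mem_filter, Finset.card_eq_zero] at hB hC
    rw [hB.2.1, hC.2.1]
  | succ l ih =>
    obtain ⟨H, hH, hit⟩ := exists_hittingSet hs x
    have hsub : minBlocks f v x (l + 1) ⊆
        H.biUnion fun i => (minBlocks f v (flipBits x {i}) l).image (insert i) := by
      intro B hB
      simp only [minBlocks, Finset.mem_filter, Finset.mem_univ, true_and] at hB
      obtain ⟨hcard, hB1, hB2⟩ := hB
      have hne : B.Nonempty := Finset.card_pos.1 (by omega)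
      -- A nonempty minimal block has `∅` as a proper subset, so `B` is sensitive at `x` and meets
      -- `H`.
      have hv : f x = v := by
        have := hB2 ∅ (Finset.empty_ssubset.2 hne)
        rwa [flipBits_empty] at this
      obtain ⟨i, hiB, hiH⟩ := hit B (by rwa [hv])
      have e : ∀ C : Finset (Fin n), i ∉ C → symmDiff {i} C = insert i C := by
        intro C hC
        ext j
        by_cases h : j = i <;> simp [Finset.mem_symmDiff, h, hC]
      refine Finset.mem_biUnion.2 ⟨i, hiH, Finset.mem_image.2 ⟨B.erase i, ?_,
        Finset.insert_erase hiB⟩⟩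
      simp only [minBlocks, Finset.mem_filter, Finset.mem_univ, true_and]
      refine ⟨by rw [Finset.card_erase_of_mem hiB, hcard]; rfl, ?_, fun C hC => ?_⟩
      · rwa [flipBits_flipBits, e _ (Finset.notMem_erase _ _), Finset.insert_erase hiB]
      · have hiC : i ∉ C := fun h => Finset.notMem_erase i B (hC.1 h)
        rw [flipBits_flipBits, e C hiC]
        refine hB2 _ ⟨?_, fun h => hC.2 fun j hj => ?_⟩
        · exact Finset.insert_subset hiB (hC.1.trans (Finset.erase_subset _ _))
        · obtain ⟨hji, hjB⟩ := Finset.mem_erase.1 hj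
          exact (Finset.mem_insert.1 (h hjB)).resolve_left hji
    calc (minBlocks f v x (l + 1)).card ≤ _ := Finset.card_le_card hsub
      _ ≤ H.card * (s * s) ^ l := Finset.card_biUnion_le_card_mul _ _ _ fun i _ =>
          Finset.card_image_le.trans (ih _)
      _ ≤ (s * s) * (s * s) ^ l := Nat.mul_le_mul_right _ hH
      _ = (s * s) ^ (l + 1) := by ring

/-- All inclusion-minimal sensitive blocks. -/
noncomputable def minSensitiveBlocks (f : (Fin n → Bool) → Bool) (x : Fin n → Bool) :
    Finset (Finset (Fin n)) :=
  open Classical in Finset.univ.filter fun B => IsMinBlock f (f x) x B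

/-- Block sizes range over `0, …, s`, and `s + 1 ≤ 2 ^ s`. -/
theorem card_minSensitiveBlocks_le (hs : BlockSensitivityLE f s) (hs1 : 1 ≤ s)
    (x : Fin n → Bool) : (minSensitiveBlocks f x).card ≤ (2 * (s * s)) ^ s := by
  classical
  have hsub : minSensitiveBlocks f x ⊆
      (Finset.range (s + 1)).biUnion fun l => minBlocks f (f x) x l := by
    intro B hB
    simp only [minSensitiveBlocks, Finset.mem_filter, Finset.mem_univ, true_and] at hB
    simp only [Finset.mem_biUnion, Finset.mem_range, minBlocks, Finset.mem_filter,
      Finset.mem_univ, true_and]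
    exact ⟨B.card, Nat.lt_succ_of_le (hB.card_le hs), rfl, hB⟩
  calc (minSensitiveBlocks f x).card ≤ _ := Finset.card_le_card hsub
    _ ≤ (Finset.range (s + 1)).card * (s * s) ^ s :=
        Finset.card_biUnion_le_card_mul _ _ _ fun l hl =>
          (card_minBlocks_le hs l _ x).trans
            (Nat.pow_le_pow_right (by positivity) (by simpa [Nat.lt_succ_iff] using hl))
    _ ≤ 2 ^ s * (s * s) ^ s := by
        rw [Finset.card_range]
        exact Nat.mul_le_mul_right _ Nat.lt_two_pow_self
    _ = _ := (mul_pow _ _ _).symm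

/-- A set of bits of `x` meeting every minimal sensitive block is a certificate. -/
theorem isCertificate_of_meets {x : Fin n → Bool} {p : Fin n → Option Bool}
    (hp : Consistent p x) (h : ∀ B ∈ minSensitiveBlocks f x, ∃ i ∈ B, p i ≠ none) :
    IsCertificate f x p := by
  classical
  refine ⟨hp, fun y hy => ?_⟩
  by_contra hne
  -- If `y` had another value, the set where `x` and `y` differ would contain a minimal sensitive
  -- block, hence a position revealed by `p`, where `x` and `y` agree.
  rw [← flipBits_filter_ne x y] at hne
  obtain ⟨B, hsub, hB⟩ := exists_isMinBlock_subset hne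
  obtain ⟨i, hi, hpi⟩ := h B (by simpa [minSensitiveBlocks] using hB)
  obtain ⟨b, hb⟩ := Option.ne_none_iff_exists'.1 hpi
  have := (Finset.mem_filter.1 (hsub hi)).2
  exact this ((hp i b hb).trans (hy i b hb).symm)

end Sensitivity

/-! ### Trace norm estimates through singular vectors. -/

section TraceNorm

variable {Z A S : Type} [Fintype Z] [Fintype A] [Fintype S]

theorem normSq_eq_norm_sq (ψ : Z → ℂ) : normSq ψ = ‖WithLp.toLp 2 ψ‖ ^ 2 := by
  rw [EuclideanSpace.norm_sq_eq]
  rfl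

theorem norm_toLp_eq_sqrt (ψ : Z → ℂ) : ‖WithLp.toLp 2 ψ‖ = √(normSq ψ) := by
  rw [normSq_eq_norm_sq, Real.sqrt_sq (norm_nonneg _)]

/-- Bessel's inequality for a normalized orthogonal family that may contain zeros. -/
theorem sum_norm_inner_sq_le_of_orthogonal {E : Type*} [NormedAddCommGroup E]
    [InnerProductSpace ℂ E] (w : A → E) (hw : ∀ a b, a ≠ b → inner ℂ (w a) (w b) = 0) (x : E) :
    ∑ a, ‖inner ℂ ((‖w a‖⁻¹ : ℂ) • w a) x‖ ^ 2 ≤ ‖x‖ ^ 2 := by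
  classical
  let u : {a // w a ≠ 0} → E := fun a => (‖w a‖⁻¹ : ℂ) • w a
  have hu : Orthonormal ℂ u := by
    refine ⟨fun a => ?_, fun a b hab => ?_⟩
    · have : ‖w a‖ ≠ 0 := norm_ne_zero_iff.2 a.2
      simp [u, norm_smul, this]
    · simp [u, inner_smul_left, inner_smul_right, hw a b fun h => hab (Subtype.ext h)]
  refine le_trans (le_of_eq ?_) (hu.sum_inner_products_le x (s := Finset.univ))
  rw [← Finset.sum_subtype (Finset.univ.filter fun a => w a ≠ 0) (by simp)
    (fun a => ‖inner ℂ ((‖w a‖⁻¹ : ℂ) • w a) x‖ ^ 2), Finset.sum_filter]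
  refine Finset.sum_congr rfl fun a _ => ?_
  by_cases h : w a = 0 <;> simp [h]

/-- Cauchy–Schwarz over pairs `(a, s)`, then Bessel for each `s`. -/
theorem sum_mul_norm_inner_le {E : Type*} [NormedAddCommGroup E] [InnerProductSpace ℂ E]
    {u v : A → E} (hu : ∀ x, ∑ a, ‖inner ℂ (u a) x‖ ^ 2 ≤ ‖x‖ ^ 2)
    (hv : ∀ x, ∑ a, ‖inner ℂ (v a) x‖ ^ 2 ≤ ‖x‖ ^ 2) (P D : S → E) :
    ∑ a, ∑ s, ‖inner ℂ (v a) (D s)‖ * ‖inner ℂ (u a) (P s)‖ ≤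
      √(∑ s, ‖D s‖ ^ 2) * √(∑ s, ‖P s‖ ^ 2) := by
  rw [← Fintype.sum_prod_type']
  refine (Real.sum_mul_le_sqrt_mul_sqrt _ _ _).trans (mul_le_mul ?_ ?_ (by positivity)
    (by positivity))
  · refine Real.sqrt_le_sqrt ?_
    rw [Fintype.sum_prod_type_right]
    exact Finset.sum_le_sum fun s _ => hv (D s)
  · refine Real.sqrt_le_sqrt ?_
    rw [Fintype.sum_prod_type_right]
    exact Finset.sum_le_sum fun s _ => hu (P s)

variable [DecidableEq A]

theorem inner_mulVec_mulVec (M : Matrix A A ℂ) (u v : EuclideanSpace ℂ A) :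
    inner ℂ (M.toEuclideanLin u) (M.toEuclideanLin v) =
      inner ℂ u ((Mᴴ * M).toEuclideanLin v) := by
  simp only [EuclideanSpace.inner_eq_star_dotProduct, Matrix.ofLp_toLpLin, Matrix.toLin'_apply]
  rw [Matrix.star_mulVec, dotProduct_comm, ← Matrix.dotProduct_mulVec, Matrix.mulVec_mulVec,
    dotProduct_comm]

/-- The trace norm is the sum of the lengths of the orthogonal images of the right singular
vectors. -/
theorem exists_singular_basis (M : Matrix A A ℂ) :
    ∃ v : OrthonormalBasis A ℂ (EuclideanSpace ℂ A),
      traceNorm M = ∑ a, ‖M.toEuclideanLin (v a)‖ ∧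
      ∀ a b, a ≠ b → inner ℂ (M.toEuclideanLin (v a)) (M.toEuclideanLin (v b)) = 0 := by
  let h := Matrix.isHermitian_conjTranspose_mul_self M
  have key : ∀ a b, inner ℂ (M.toEuclideanLin (h.eigenvectorBasis a))
      (M.toEuclideanLin (h.eigenvectorBasis b)) =
      (h.eigenvalues b : ℂ) * inner ℂ (h.eigenvectorBasis a) (h.eigenvectorBasis b) := by
    intro a b
    rw [inner_mulVec_mulVec, ← inner_smul_right]
    congr 1
    rw [Matrix.toLpLin_apply, h.mulVec_eigenvectorBasis]
    rfl
  refine ⟨h.eigenvectorBasis, ?_, fun a b hab => ?_⟩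
  · refine Finset.sum_congr rfl fun a _ => ?_
    have := key a a
    rw [inner_self_eq_norm_sq_to_K, inner_self_eq_norm_sq_to_K, h.eigenvectorBasis.norm_eq_one]
      at this
    have h2 : ‖M.toEuclideanLin (h.eigenvectorBasis a)‖ ^ 2 = h.eigenvalues a := by
      have h3 : ((‖M.toEuclideanLin (h.eigenvectorBasis a)‖ ^ 2 : ℝ) : ℂ) = h.eigenvalues a := by
        simpa using this
      exact_mod_cast h3
    change √(h.eigenvalues a) = _
    rw [← h2, Real.sqrt_sq (norm_nonneg _)]
  · rw [key, h.eigenvectorBasis.inner_eq_zero hab, mul_zero]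

/-- Write `|ψ⟩⟨ψ| - |φ⟩⟨φ| = |ψ⟩⟨ψ - φ| + |ψ - φ⟩⟨φ|` before the partial trace, and pair left with
right singular vectors in each term. -/
theorem traceNorm_reducedState_sub_le (e : Z ≃ A × S) (ψ φ : Z → ℂ) :
    traceNorm (reducedState e ψ - reducedState e φ) ≤
      (‖WithLp.toLp 2 ψ‖ + ‖WithLp.toLp 2 φ‖) * ‖WithLp.toLp 2 (ψ - φ)‖ := by
  obtain ⟨v, hv, hw⟩ := exists_singular_basis (reducedState e ψ - reducedState e φ)
  set M := reducedState e ψ - reducedState e φ with hM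
  let vec : (Z → ℂ) → S → EuclideanSpace ℂ A := fun χ s => WithLp.toLp 2 fun a => χ (e.symm (a, s))
  have hvec : ∀ χ, √(∑ s, ‖vec χ s‖ ^ 2) = ‖WithLp.toLp 2 χ‖ := by
    intro χ
    rw [norm_toLp_eq_sqrt, normSq, ← e.symm.sum_comp, Fintype.sum_prod_type_right]
    simp only [vec, EuclideanSpace.norm_sq_eq]
  -- The left singular vectors; since `0⁻¹ = 0`, those for singular value zero vanish, and Bessel
  -- still holds.
  let u : A → EuclideanSpace ℂ A := fun a =>
    (‖M.toEuclideanLin (v a)‖⁻¹ : ℂ) • M.toEuclideanLin (v a)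
  have hu : ∀ x, ∑ a, ‖inner ℂ (u a) x‖ ^ 2 ≤ ‖x‖ ^ 2 :=
    sum_norm_inner_sq_le_of_orthogonal _ hw
  have hv' : ∀ x, ∑ a, ‖inner ℂ (v a) x‖ ^ 2 ≤ ‖x‖ ^ 2 := fun x =>
    (v.sum_sq_norm_inner_right x).le
  have hMv : ∀ x : EuclideanSpace ℂ A, M.toEuclideanLin x = ∑ s,
      (inner ℂ (vec (ψ - φ) s) x • vec ψ s + inner ℂ (vec φ s) x • vec (ψ - φ) s) := by
    intro x
    ext a
    have l : (M.toEuclideanLin x).ofLp a = ∑ b, (∑ s, ψ (e.symm (a, s)) * star (ψ (e.symm (b, s))) -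
        ∑ s, φ (e.symm (a, s)) * star (φ (e.symm (b, s)))) * x b := rfl
    rw [l, WithLp.ofLp_sum, Finset.sum_apply]
    simp only [← Finset.sum_sub_distrib, Finset.sum_mul]
    rw [Finset.sum_comm]
    refine Finset.sum_congr rfl fun s _ => ?_
    simp only [vec, PiLp.add_apply, PiLp.smul_apply, smul_eq_mul, PiLp.inner_apply,
      RCLike.inner_apply, Pi.sub_apply, map_sub, Finset.sum_mul, ← Finset.sum_add_distrib]
    refine Finset.sum_congr rfl fun b _ => ?_
    simp only [RCLike.star_def]
    ring
  have hnorm : ∀ a, ‖M.toEuclideanLin (v a)‖ ≤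
      ∑ s, ‖inner ℂ (v a) (vec (ψ - φ) s)‖ * ‖inner ℂ (u a) (vec ψ s)‖ +
      ∑ s, ‖inner ℂ (v a) (vec φ s)‖ * ‖inner ℂ (u a) (vec (ψ - φ) s)‖ := by
    intro a
    have h1 : ‖M.toEuclideanLin (v a)‖ = ‖inner ℂ (u a) (M.toEuclideanLin (v a))‖ := by
      rw [inner_smul_left, inner_self_eq_norm_sq_to_K]
      by_cases h : ‖M.toEuclideanLin (v a)‖ = 0
      · simp [h]
      · simp only [map_inv₀, norm_mul, norm_inv, norm_pow, Complex.conj_ofReal, Complex.norm_real,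
          Complex.coe_algebraMap, norm_norm]
        field_simp
    rw [h1, hMv, inner_sum, ← Finset.sum_add_distrib]
    refine (norm_sum_le _ _).trans (Finset.sum_le_sum fun s _ => ?_)
    rw [inner_add_right, inner_smul_right, inner_smul_right, norm_inner_symm (v a),
      norm_inner_symm (v a), ← norm_mul, ← norm_mul]
    exact norm_add_le _ _
  calc traceNorm M = _ := hv
    _ ≤ _ := Finset.sum_le_sum fun a _ => hnorm a
    _ ≤ ‖WithLp.toLp 2 (ψ - φ)‖ * ‖WithLp.toLp 2 ψ‖ +
        ‖WithLp.toLp 2 φ‖ * ‖WithLp.toLp 2 (ψ - φ)‖ := by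
      rw [Finset.sum_add_distrib, ← hvec, ← hvec, ← hvec]
      exact add_le_add (sum_mul_norm_inner_le hu hv' _ _) (sum_mul_norm_inner_le hu hv' _ _)
    _ = _ := by ring

/-- The sum is the trace of `diagonal δ * M`; in the right singular basis each term is at most a
singular value, as `diagonal δ` is a contraction. With signs `δ` it turns measurement statistics
into trace distance. -/
theorem abs_sum_mul_diag_le_traceNorm (M : Matrix A A ℂ) (δ : A → ℂ) (hδ : ∀ a, ‖δ a‖ ≤ 1) :
    ‖∑ a, δ a * M a a‖ ≤ traceNorm M := by
  obtain ⟨v, hv, -⟩ := exists_singular_basis M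
  have htr : ∑ a, δ a * M a a = ∑ b, inner ℂ (v b) ((Matrix.diagonal δ * M).toEuclideanLin (v b)) := by
    rw [← LinearMap.trace_eq_sum_inner, Matrix.toEuclideanLin_eq_toLin_orthonormal,
      Matrix.trace_toLin_eq]
    simp [Matrix.trace, Matrix.diagonal_mul]
  rw [htr, hv]
  refine (norm_sum_le _ _).trans (Finset.sum_le_sum fun b _ => ?_)
  refine (norm_inner_le_norm _ _).trans ?_
  rw [v.norm_eq_one, one_mul, EuclideanSpace.norm_eq, EuclideanSpace.norm_eq]
  refine Real.sqrt_le_sqrt (Finset.sum_le_sum fun a _ => ?_)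
  simp only [Matrix.ofLp_toLpLin, Matrix.toLin'_apply, ← Matrix.mulVec_mulVec,
    Matrix.mulVec_diagonal, norm_mul]
  gcongr
  exact mul_le_of_le_one_left (norm_nonneg _) (hδ a)

end TraceNorm

/-! ### The hybrid argument and the block sensitivity bound. -/

section Hybrid

variable {n : ℕ} {W : Type} [Fintype W] [DecidableEq W]

/-- The oracles differ only on indices in `B`, where `|a - b|² ≤ 2|a|² + 2|b|²`; each oracle
permutes the basis and fixes the index, so each square sums to the query weight. -/
theorem normSq_oracle_sub_le (x : Fin n → Bool) (B : Finset (Fin n)) (ψ : Basis n W → ℂ) :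
    normSq (oracle x *ᵥ ψ - oracle (flipBits x B) *ᵥ ψ) ≤ 4 * queryWeight ψ B := by
  classical
  let F : Basis n W → ℝ := fun z => if ∃ i ∈ B, z.1 = some i then ‖ψ z‖ ^ 2 else 0
  have hF : ∀ y : Fin n → Bool, ∑ z, F (oracleMap y z) = queryWeight ψ B := fun y =>
    Equiv.sum_comp (oraclePerm y) F
  have hle : normSq (oracle x *ᵥ ψ - oracle (flipBits x B) *ᵥ ψ) ≤
      ∑ z, (2 * F (oracleMap x z) + 2 * F (oracleMap (flipBits x B) z)) := by
    refine Finset.sum_le_sum fun z _ => ?_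
    simp only [F, oracleMap_fst, oracle_mulVec, Pi.sub_apply, Function.comp_apply]
    split_ifs with h
    · have := norm_sub_le (ψ (oracleMap x z)) (ψ (oracleMap (flipBits x B) z))
      nlinarith [sq_nonneg (‖ψ (oracleMap x z)‖ - ‖ψ (oracleMap (flipBits x B) z)‖),
        norm_nonneg (ψ (oracleMap x z) - ψ (oracleMap (flipBits x B) z))]
    · have : oracleMap x z = oracleMap (flipBits x B) z := by
        obtain ⟨_ | i, b, w⟩ := z
        · rfl
        · have hi : i ∉ B := fun hi => h ⟨i, hi, rfl⟩
          simp [oracleMap, flipBits, hi]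
      simp [this]
  refine hle.trans (le_of_eq ?_)
  rw [Finset.sum_add_distrib, ← Finset.mul_sum, ← Finset.mul_sum, hF, hF]
  ring

/-- The hybrid argument. -/
theorem norm_state_sub_le (A : Algorithm n W) (x : Fin n → Bool) (B : Finset (Fin n)) (k : ℕ) :
    ‖WithLp.toLp 2 (A.state x k - A.state (flipBits x B) k)‖ ≤
      2 * ∑ t ∈ Finset.range k, √(queryWeight (A.state x t) B) := by
  induction k with
  | zero => simp [Algorithm.state]
  | succ k ih =>
    set y := flipBits x B with hy
    -- The new difference comes from swapping the oracle on the current state; the old one is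
    -- carried along isometrically.
    have e : A.state x (k + 1) - A.state y (k + 1) = (A.U (k + 1)).1 *ᵥ
        ((oracle x *ᵥ A.state x k - oracle y *ᵥ A.state x k) +
          oracle y *ᵥ (A.state x k - A.state y k)) := by
      simp only [Algorithm.state, Matrix.mulVec_sub, Matrix.mulVec_add]
      abel
    rw [e, norm_toLp_eq_sqrt, normSq_mulVec, ← norm_toLp_eq_sqrt, WithLp.toLp_add,
      Finset.sum_range_succ, mul_add, add_comm (2 * _)]
    refine (norm_add_le _ _).trans (add_le_add ?_ ?_)
    · rw [norm_toLp_eq_sqrt]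
      refine (Real.sqrt_le_sqrt (normSq_oracle_sub_le x B _)).trans (le_of_eq ?_)
      rw [Real.sqrt_mul (by norm_num), show (4 : ℝ) = 2 ^ 2 by norm_num,
        Real.sqrt_sq (by norm_num)]
    · rw [norm_toLp_eq_sqrt, normSq_oracle, ← norm_toLp_eq_sqrt]
      exact ih

/-- `A` queries each sensitive block with total weight at least `1 / (144 k)`. -/
theorem one_le_sum_queryWeight {f : (Fin n → Bool) → Bool} {k : ℕ} (A : Algorithm n W)
    {K S : Type} [Fintype K] [DecidableEq K] [Fintype S] (e : Basis n W ≃ K × S)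
    (h : ∀ x y, f x ≠ f y →
      1 / 6 ≤ traceDist (reducedState e (A.state x k)) (reducedState e (A.state y k)))
    (x : Fin n → Bool) (B : Finset (Fin n)) (hB : f (flipBits x B) ≠ f x) :
    1 ≤ 144 * k * ∑ t ∈ Finset.range k, queryWeight (A.state x t) B := by
  have h1 := h x (flipBits x B) hB.symm
  have h2 := traceNorm_reducedState_sub_le e (A.state x k) (A.state (flipBits x B) k)
  rw [norm_toLp_eq_sqrt (A.state x k), norm_toLp_eq_sqrt (A.state (flipBits x B) k),
    A.normSq_state, A.normSq_state, Real.sqrt_one] at h2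
  have h3 := norm_state_sub_le A x B k
  rw [traceDist] at h1
  -- Trace norm at least `1/3`, at most twice the state distance, hence at most four times this sum.
  -- Squaring with Cauchy–Schwarz over `k` times gives `144 k`.
  have h4 : 1 / 12 ≤ ∑ t ∈ Finset.range k, √(queryWeight (A.state x t) B) := by linarith
  have h5 := sq_sum_le_card_mul_sum_sq (s := Finset.range k)
    (f := fun t => √(queryWeight (A.state x t) B))
  simp only [Real.sq_sqrt (queryWeight_nonneg _ _), Finset.card_range] at h5
  nlinarith

theorem sum_queryWeight_le (A : Algorithm n W) (x : Fin n → Bool) (t : ℕ)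
    (𝓑 : Finset (Finset (Fin n))) (hd : (𝓑 : Set (Finset (Fin n))).PairwiseDisjoint id) :
    ∑ B ∈ 𝓑, queryWeight (A.state x t) B ≤ 1 := by
  classical
  rw [← A.normSq_state x t]
  simp only [queryWeight]
  rw [Finset.sum_comm]
  refine Finset.sum_le_sum fun z _ => ?_
  by_cases h : ∃ B ∈ 𝓑, ∃ i ∈ B, z.1 = some i
  · obtain ⟨B, hB, i, hi, hz⟩ := h
    rw [Finset.sum_eq_single B]
    · split_ifs <;> simp
    · intro C hC hne
      refine if_neg ?_
      rintro ⟨j, hj, hz'⟩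
      obtain rfl : i = j := Option.some.inj (hz.symm.trans hz')
      exact Finset.disjoint_left.1 (hd hC hB hne) hj hi
    · exact fun h => absurd hB h
  · push Not at h
    rw [Finset.sum_eq_zero]
    · positivity
    · intro B hB
      refine if_neg ?_
      rintro ⟨i, hi, hz⟩
      exact h B hB i hi hz

/-- Sum the weight bound over the disjoint blocks; at each of the `k` times their total weight is at
most `1`. -/
theorem blockSensitivityLE_of_distinguishes {f : (Fin n → Bool) → Bool} {k : ℕ}
    (A : Algorithm n W)
    {K S : Type} [Fintype K] [DecidableEq K] [Fintype S] (e : Basis n W ≃ K × S)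
    (h : ∀ x y, f x ≠ f y →
      1 / 6 ≤ traceDist (reducedState e (A.state x k)) (reducedState e (A.state y k))) :
    BlockSensitivityLE f (144 * k ^ 2) := by
  intro x 𝓑 hd hs
  have h1 : (𝓑.card : ℝ) ≤ ∑ B ∈ 𝓑, 144 * k * ∑ t ∈ Finset.range k,
      queryWeight (A.state x t) B := by
    rw [Finset.card_eq_sum_ones, Nat.cast_sum]
    refine Finset.sum_le_sum fun B hB => ?_
    simpa using one_le_sum_queryWeight A e h x B (hs B hB)
  rw [← Finset.mul_sum, Finset.sum_comm] at h1
  have h2 : ∑ t ∈ Finset.range k, ∑ B ∈ 𝓑, queryWeight (A.state x t) B ≤ k := by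
    refine (Finset.sum_le_sum fun t _ => sum_queryWeight_le A x t 𝓑 hd).trans ?_
    simp
  have h3 : (𝓑.card : ℝ) ≤ 144 * k * k :=
    h1.trans (mul_le_mul_of_nonneg_left h2 (by positivity))
  have h4 : (𝓑.card : ℝ) ≤ ((144 * k ^ 2 : ℕ) : ℝ) := by push_cast; linarith
  exact_mod_cast h4

end Hybrid

/-! ### Certificates from exploration, and comparisons of the computation models. -/

section Reductions

variable {n : ℕ} {f : (Fin n → Bool) → Bool} {k : ℕ}

theorem outProb_ne_zero_of {Z R : Type} [Fintype Z] [DecidableEq R] {ψ : Z → ℂ} (out : Z → R)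
    {z : Z} (hz : ψ z ≠ 0) : outProb ψ out (out z) ≠ 0 := by
  have h : ‖ψ z‖ ^ 2 ≤ outProb ψ out (out z) :=
    Finset.single_le_sum (f := fun z => ‖ψ z‖ ^ 2) (fun _ _ => by positivity) (by simp)
  have : 0 < ‖ψ z‖ ^ 2 := by positivity
  linarith

theorem exists_of_outProb_ne_zero {Z R : Type} [Fintype Z] [DecidableEq R] {ψ : Z → ℂ}
    {out : Z → R} {r : R} (h : outProb ψ out r ≠ 0) : ∃ z, out z = r ∧ ψ z ≠ 0 := by
  obtain ⟨z, hz, h'⟩ := Finset.exists_ne_zero_of_sum_ne_zero h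
  exact ⟨z, (Finset.mem_filter.1 hz).2, fun h0 => h' (by simp [h0])⟩

/-- An exploration that rarely misses a minimal sensitive block yields certificates. -/
theorem Explores.exists_selfCertifying {q : (Fin n → Bool) → Finset (Fin n) → ℝ}
    (hq : Explores k q) {ε : ℝ} (hε : ∀ x, ∑ B ∈ minSensitiveBlocks f x, q x B ≤ ε) :
    ∃ (W : Type) (_ : Fintype W) (_ : DecidableEq W) (A : Algorithm n W)
      (out : Basis n W → Option (Bool × (Fin n → Option Bool))),
      ∀ x, (∀ b p, outProb (A.state x k) out (some (b, p)) ≠ 0 → b = f x ∧ IsCertificate f x p) ∧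
        outProb (A.state x k) out none ≤ ε := by
  classical
  obtain ⟨W, i1, i2, A, found, hA⟩ := hq
  refine ⟨W, i1, i2, A, fun z => if h : ∃ c, ∀ y, Consistent (found z) y → f y = c then
    some (h.choose, found z) else none, fun x => ⟨fun b p hbp => ?_, ?_⟩⟩
  · obtain ⟨z, hz, h0⟩ := exists_of_outProb_ne_zero hbp
    have hc := (hA x).1 z h0
    split_ifs at hz with h
    have hspec := h.choose_spec
    simp only [Option.some.injEq, Prod.mk.injEq] at hz
    obtain ⟨rfl, rfl⟩ := hz
    exact ⟨(hspec x hc).symm, hc, fun y hy => (hspec y hy).trans (hspec x hc).symm⟩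
  · refine le_trans ?_ (hε x)
    refine le_trans ?_ (Finset.sum_le_sum fun B _ => (hA x).2 B)
    simp only [missProb]
    rw [outProb, Finset.sum_filter, Finset.sum_comm]
    refine Finset.sum_le_sum fun z _ => ?_
    have hnn : ∀ B ∈ minSensitiveBlocks f x,
        0 ≤ if ∀ i ∈ B, found z i = none then ‖A.state x k z‖ ^ 2 else 0 :=
      fun B _ => by split_ifs <;> positivity
    by_cases h0 : A.state x k z = 0
    · simp [h0]
    by_cases h : ∃ c, ∀ y, Consistent (found z) y → f y = c
    · simpa [h] using Finset.sum_nonneg hnn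
    have hc := (hA x).1 z h0
    -- Union bound: an inconclusive outcome must have missed a minimal sensitive block, else it
    -- would be a certificate.
    have : ∃ B ∈ minSensitiveBlocks f x, ∀ i ∈ B, found z i = none := by
      by_contra! hno
      exact h ⟨f x, (isCertificate_of_meets hc hno).2⟩
    obtain ⟨B, hB, hmiss⟩ := this
    refine le_trans (le_of_eq ?_) (Finset.single_le_sum hnn hB)
    rw [if_pos hmiss, dif_neg h, if_pos rfl]

theorem boundedErrorComputable_all (f : (Fin n → Bool) → Bool) : BoundedErrorComputable f n := by
  obtain ⟨W, i1, i2, A, out, h⟩ := (explores_all (n := n)).exists_selfCertifying (f := f) (ε := 0)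
    fun x => Finset.sum_nonpos fun B hB => by
      have hB : IsMinBlock f (f x) x B := by simpa [minSensitiveBlocks] using hB
      simp [hB.nonempty]
  refine ⟨W, i1, i2, A, fun z => ((out z).map Prod.fst).getD false, fun x => ?_⟩
  have key : ∀ z, A.state x n z ≠ 0 → ((out z).map Prod.fst).getD false = f x := by
    intro z hz
    have h0 := outProb_ne_zero_of out hz
    rcases ho : out z with _ | ⟨b, p⟩
    · rw [ho] at h0
      exact absurd (le_antisymm (h x).2 (Finset.sum_nonneg fun _ _ => by positivity)) h0
    · rw [ho] at h0
      exact ((h x).1 b p h0).1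
  have : outProb (A.state x n) (fun z => ((out z).map Prod.fst).getD false) (f x) = 1 := by
    rw [← A.normSq_state x n, outProb, normSq, Finset.sum_filter]
    refine Finset.sum_congr rfl fun z _ => ?_
    by_cases hz : A.state x n z = 0
    · simp [hz]
    · rw [if_pos (key z hz)]
  rw [this]
  norm_num

theorem SelfCertifyingComputable.zeroErrorComputable (h : SelfCertifyingComputable f k) :
    ZeroErrorComputable f k := by
  obtain ⟨W, i1, i2, A, out, h⟩ := h
  refine ⟨W, i1, i2, A, fun z => (out z).map Prod.fst, fun x => ⟨?_, ?_⟩⟩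
  · by_contra hne
    obtain ⟨z, hz, h0⟩ := exists_of_outProb_ne_zero hne
    obtain ⟨⟨b, p⟩, ho, hb⟩ := Option.map_eq_some_iff.1 hz
    have := outProb_ne_zero_of out h0
    rw [ho] at this
    have := ((h x).1 b p this).1
    simp_all
  · simpa [outProb] using (h x).2

/-- Nothing is discarded. The `±1` observable for the output has expectation at least `1/3` on `x`
and at most `-1/3` on `y`, so the trace distance is at least `1/3`. -/
theorem BoundedErrorComputable.distinguishable (h : BoundedErrorComputable f k) :
    Distinguishable f k := by
  obtain ⟨W, i1, i2, A, out, h⟩ := h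
  refine ⟨W, i1, i2, A, Basis n W, Unit, inferInstance, inferInstance, inferInstance,
    (Equiv.prodPUnit _).symm, fun x y hxy => ?_⟩
  have hsplit : ∀ u, outProb (A.state u k) out (f x) + outProb (A.state u k) out (!f x) = 1 := by
    intro u
    rw [← A.normSq_state u k, normSq, outProb, outProb,
      ← Finset.sum_filter_add_sum_filter_not Finset.univ fun z => out z = f x]
    congr 2
    ext z
    simp [Bool.eq_not_iff]
  have hy : (!f x) = f y := by cases hx : f x <;> cases hy : f y <;> simp_all
  have h1 := h x
  have h2 := h y
  rw [← hy] at h2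
  have h3 := hsplit y
  have h4 := hsplit x
  have key : ∀ u, ∑ z, (if out z = f x then 1 else -1 : ℂ) *
      reducedState (Equiv.prodPUnit (Basis n W)).symm (A.state u k) z z =
      ((outProb (A.state u k) out (f x) - outProb (A.state u k) out (!f x) : ℝ) : ℂ) := by
    intro u
    rw [outProb, outProb, Finset.sum_filter, Finset.sum_filter, ← Finset.sum_sub_distrib,
      Complex.ofReal_sum]
    refine Finset.sum_congr rfl fun z _ => ?_
    have : reducedState (Equiv.prodPUnit (Basis n W)).symm (A.state u k) z z =
        ((‖A.state u k z‖ ^ 2 : ℝ) : ℂ) := by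
      simp [reducedState, Complex.mul_conj, Complex.normSq_eq_norm_sq]
    rw [this]
    by_cases hz : out z = f x <;> simp [hz, Bool.eq_not_iff]
  have h5 := abs_sum_mul_diag_le_traceNorm
    (reducedState (Equiv.prodPUnit (Basis n W)).symm (A.state x k) -
      reducedState (Equiv.prodPUnit (Basis n W)).symm (A.state y k))
    (fun z => if out z = f x then 1 else -1) (fun z => by split_ifs <;> simp)
  simp only [Matrix.sub_apply, mul_sub, Finset.sum_sub_distrib, key] at h5
  rw [← Complex.ofReal_sub, Complex.norm_real] at h5
  have h6 := (le_abs_self _).trans h5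
  rw [traceDist]
  linarith

end Reductions

/-! ### Repetition, union bound and the query count. -/

section Upper

variable {n : ℕ} {f : (Fin n → Bool) → Bool} {k : ℕ}

theorem queryWeight_state_le_one {W : Type} [Fintype W] [DecidableEq W] (A : Algorithm n W)
    (x : Fin n → Bool) (t : ℕ) (B : Finset (Fin n)) : queryWeight (A.state x t) B ≤ 1 := by
  simpa using sum_queryWeight_le A x t {B} (by simp)

/-- Repeating the measurement of the index register at each time `m` times. -/
theorem explores_repeat {W : Type} [Fintype W] [DecidableEq W] (A : Algorithm n W) (k m : ℕ) :
    ∃ l ≤ m * k ^ 2, Explores l fun x B =>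
      Real.exp (-(m * ∑ t ∈ Finset.range k, queryWeight (A.state x t) B)) := by
  have h := Explores.prod (Finset.range m) fun _ _ =>
    Explores.prod (Finset.range k) fun t _ => Explores.measure A t
  refine ⟨_, ?_, h.mono fun x B => ?_⟩
  · rw [Finset.sum_const, Finset.card_range, smul_eq_mul]
    refine Nat.mul_le_mul_left _ ?_
    calc ∑ t ∈ Finset.range k, (t + 1) ≤ ∑ t ∈ Finset.range k, k :=
          Finset.sum_le_sum fun t ht => Finset.mem_range.1 ht
      _ = k ^ 2 := by simp [sq]
  · rw [Finset.prod_const, Finset.card_range, ← mul_neg, Real.exp_nat_mul, ← Finset.sum_neg_distrib,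
      Real.exp_sum]
    refine pow_le_pow_left₀ (Finset.prod_nonneg fun t _ => ?_) (Finset.prod_le_prod (fun t _ => ?_)
      fun t _ => ?_) _
    · exact sub_nonneg.2 (queryWeight_state_le_one A x t B)
    · exact sub_nonneg.2 (queryWeight_state_le_one A x t B)
    -- This is `1 - q ≤ exp (-q)`.
    · linarith [Real.add_one_le_exp (-queryWeight (A.state x t) B)]

/-- With `s = 144 k²`, `2 s² = 41472 k⁴ ≤ (k + 1) ^ 20` because `41472 ≤ 2 ^ 16`; the exponent is
`20 * 144 = 2880`. -/
theorem card_minSensitiveBlocks_le_exp (hk : 1 ≤ k) (hs : BlockSensitivityLE f (144 * k ^ 2))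
    (x : Fin n → Bool) :
    ((minSensitiveBlocks f x).card : ℝ) ≤ Real.exp (2880 * k ^ 2 * Real.log (k + 1)) := by
  have hb : 2 * ((144 * k ^ 2) * (144 * k ^ 2)) ≤ (k + 1) ^ 20 := by
    calc 2 * ((144 * k ^ 2) * (144 * k ^ 2)) = 41472 * k ^ 4 := by ring
      _ ≤ (k + 1) ^ 16 * (k + 1) ^ 4 := by
        refine Nat.mul_le_mul ?_ (Nat.pow_le_pow_left (by omega) 4)
        exact le_trans (by norm_num) (Nat.pow_le_pow_left (show 2 ≤ k + 1 by omega) 16)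
      _ = _ := by ring
  have h1 := (card_minSensitiveBlocks_le hs (by nlinarith) x).trans (Nat.pow_le_pow_left hb _)
  rw [← pow_mul] at h1
  calc ((minSensitiveBlocks f x).card : ℝ) ≤ (((k + 1) ^ (20 * (144 * k ^ 2)) : ℕ) : ℝ) := by
        exact_mod_cast h1
    _ = Real.exp (2880 * k ^ 2 * Real.log (k + 1)) := by
        push_cast
        rw [← Real.exp_log (show (0 : ℝ) < k + 1 by positivity), ← Real.exp_nat_mul,
          Real.log_exp]
        congr 1
        push_cast
        ring

theorem Distinguishable.exists_selfCertifying (h : Distinguishable f k) :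
    ∃ l : ℕ, SelfCertifyingComputable f l ∧
      (l : ℝ) ≤ 414866 * ((k : ℝ) ^ 5 * Real.log (k + 1)) := by
  obtain ⟨W, i1, i2, A, K, S, i3, i4, i5, e, h⟩ := h
  rcases Nat.eq_zero_or_pos k with rfl | hk
  -- Without queries the weight sum is empty, so no sensitive block exists and the empty certificate
  -- works.
  · refine ⟨0, explores_zero.exists_selfCertifying fun x => ?_, by simp⟩
    have : minSensitiveBlocks f x = ∅ := by
      refine Finset.eq_empty_of_forall_notMem fun B hB => ?_
      have hB : IsMinBlock f (f x) x B := by simpa [minSensitiveBlocks] using hB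
      have := one_le_sum_queryWeight A e h x B hB.1
      norm_num at this
    rw [this]
    norm_num
  · have hs := blockSensitivityLE_of_distinguishes A e h
    set L := Real.log (k + 1) with hL
    have hk1 : (1 : ℝ) ≤ k := by exact_mod_cast hk
    have hL2 : Real.log 2 ≤ L := Real.log_le_log (by norm_num) (by linarith)
    have hLhalf : 1 / 2 ≤ L := by linarith [Real.log_two_gt_d9]
    -- The factor `144 k` offsets the weight bound. Using `2881` instead of `2880` leaves a surplus
    -- `k² L ≥ log 2`, which brings the union bound down to `1/2`.
    set m := ⌈144 * k * (2881 * k ^ 2 * L)⌉₊ with hm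
    have hm1 : 144 * k * (2881 * k ^ 2 * L) ≤ m := Nat.le_ceil _
    have hm2 : (m : ℝ) ≤ 144 * k * (2881 * k ^ 2 * L) + 1 :=
      (Nat.ceil_lt_add_one (by positivity)).le
    obtain ⟨l, hl, hE⟩ := explores_repeat A k m
    refine ⟨l, hE.exists_selfCertifying fun x => ?_, ?_⟩
    · have hterm : ∀ B ∈ minSensitiveBlocks f x,
          Real.exp (-(m * ∑ t ∈ Finset.range k, queryWeight (A.state x t) B)) ≤
            Real.exp (-(2881 * k ^ 2 * L)) := by
        intro B hB
        have hB : IsMinBlock f (f x) x B := by simpa [minSensitiveBlocks] using hB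
        have hw := one_le_sum_queryWeight A e h x B hB.1
        set w := ∑ t ∈ Finset.range k, queryWeight (A.state x t) B
        have hw0 : 0 ≤ w := Finset.sum_nonneg fun t _ => queryWeight_nonneg _ _
        refine Real.exp_le_exp.2 (neg_le_neg ?_)
        calc 2881 * k ^ 2 * L ≤ (2881 * k ^ 2 * L) * (144 * k * w) :=
              le_mul_of_one_le_right (by positivity) hw
          _ = 144 * k * (2881 * k ^ 2 * L) * w := by ring
          _ ≤ m * w := mul_le_mul_of_nonneg_right hm1 hw0
      refine (Finset.sum_le_card_nsmul _ _ _ hterm).trans ?_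
      rw [nsmul_eq_mul]
      refine (mul_le_mul_of_nonneg_right (card_minSensitiveBlocks_le_exp hk hs x)
        (Real.exp_nonneg _)).trans ?_
      rw [← Real.exp_add]
      calc Real.exp (2880 * k ^ 2 * Real.log (k + 1) + -(2881 * k ^ 2 * L))
          ≤ Real.exp (-Real.log 2) := by
            refine Real.exp_le_exp.2 ?_
            rw [← hL]
            nlinarith [one_le_pow₀ hk1 (n := 2)]
        _ = 1 / 2 := by rw [Real.exp_neg, Real.exp_log (by norm_num)]; norm_num
    · have h1 : (l : ℝ) ≤ m * k ^ 2 := by exact_mod_cast hl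
      -- Rounding `m` up costs at most `k²` queries, absorbed since `L ≥ 1/2`; hence `414866 = 144 *
      -- 2881 + 2`.
      have h2 : (k : ℝ) ^ 2 ≤ 2 * (k ^ 5 * L) := by
        have : (k : ℝ) ^ 2 ≤ k ^ 5 := pow_le_pow_right₀ hk1 (by norm_num)
        nlinarith [show (0 : ℝ) ≤ (k : ℝ) ^ 5 by positivity]
      calc (l : ℝ) ≤ (144 * k * (2881 * k ^ 2 * L) + 1) * k ^ 2 :=
            h1.trans (mul_le_mul_of_nonneg_right hm2 (by positivity))
        _ ≤ _ := by nlinarith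

end Upper

end QuantumQuery

theorem theorem1 :
    ∃ C : ℝ, 0 < C ∧ ∀ (n : ℕ) (f : (Fin n → Bool) → Bool),
      (QuantumQuery.Q₀ f : ℝ) ≤
        C * ((QuantumQuery.QS f : ℝ) ^ 5 * Real.log (QuantumQuery.QS f + 1)) ∧
      (QuantumQuery.QS f : ℝ) ^ 5 * Real.log (QuantumQuery.QS f + 1) ≤
        C * ((QuantumQuery.Q f : ℝ) ^ 5 * Real.log (QuantumQuery.Q f + 1)) ∧
      (QuantumQuery.Q₀ f : ℝ) ≤
        C * ((QuantumQuery.Q f : ℝ) ^ 5 * Real.log (QuantumQuery.Q f + 1)) ∧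
      ∃ k : ℕ, QuantumQuery.SelfCertifyingComputable f k ∧
        (k : ℝ) ≤ C * ((QuantumQuery.QS f : ℝ) ^ 5 * Real.log (QuantumQuery.QS f + 1)) ∧
        (k : ℝ) ≤ C * ((QuantumQuery.Q f : ℝ) ^ 5 * Real.log (QuantumQuery.Q f + 1)) := by
  refine ⟨414866, by norm_num, fun n f => ?_⟩
  -- As `sInf ∅ = 0`, attaining the infimum requires a witness: reading all `n` bits.
  have hQ : QuantumQuery.BoundedErrorComputable f (QuantumQuery.Q f) :=
    Nat.sInf_mem (s := {k | QuantumQuery.BoundedErrorComputable f k})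
      ⟨n, QuantumQuery.boundedErrorComputable_all f⟩
  have hQS : QuantumQuery.Distinguishable f (QuantumQuery.QS f) :=
    Nat.sInf_mem (s := {k | QuantumQuery.Distinguishable f k}) ⟨_, hQ.distinguishable⟩
  have hle : QuantumQuery.QS f ≤ QuantumQuery.Q f := Nat.sInf_le hQ.distinguishable
  have hmono : (QuantumQuery.QS f : ℝ) ^ 5 * Real.log (QuantumQuery.QS f + 1) ≤
      (QuantumQuery.Q f : ℝ) ^ 5 * Real.log (QuantumQuery.Q f + 1) := by
    gcongr
    exact Real.log_nonneg (by linarith [(QuantumQuery.QS f).cast_nonneg (α := ℝ)])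
  have hnn : 0 ≤ (QuantumQuery.Q f : ℝ) ^ 5 * Real.log (QuantumQuery.Q f + 1) :=
    mul_nonneg (by positivity)
      (Real.log_nonneg (by linarith [(QuantumQuery.Q f).cast_nonneg (α := ℝ)]))
  obtain ⟨k, hk, hkle⟩ := hQS.exists_selfCertifying
  have hQ₀ : (QuantumQuery.Q₀ f : ℝ) ≤ k := by
    exact_mod_cast Nat.sInf_le hk.zeroErrorComputable
  have hkQ := hkle.trans (mul_le_mul_of_nonneg_left hmono (by norm_num : (0 : ℝ) ≤ 414866))
  exact ⟨hQ₀.trans hkle, by linarith, hQ₀.trans hkQ, k, hk, hkle, hkQ⟩
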